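/- **Definitions.** Let $K$ be a number field with ring of integers $\mathcal{O}_K$, let $\mathfrak{P}$ be a nonzero prime ideal of $\mathcal{O}_K$, and let $K_{\mathfrak{P}}$ be the completion of $K$ with respect to the $\mathfrak{P}$-adic absolute value $|\cdot|_{\mathfrak{P}}$. A *$\mathfrak{P}$-adic floor function* for $K$ is a function $s\colon K_{\mathfrak{P}}\to K$ such that - (a) $|\alpha-s(\alpha)|_{\mathfrak{P}}<1$ for every $\alpha\in K_{\mathfrak{P}}$; - (b) $|s(\alpha)|_v\le 1$ for every $\alpha\in K_{\mathfrak{P}}$ and every non-archimedean place $v$ of $K$ different from $\mathfrak{P}$; - (c) $s(0)=0$ and $s\circ s=s$ (where $K$ is viewed inside $K_{\mathfrak{P}}$); - (d) $s(\alpha)=s(\beta)$ whenever $\alpha,\beta\in K_{\mathfrak{P}}$ and $|\alpha-\beta|_{\mathfrak{P}}<1$. Given $\alpha\in K_{\mathfrak{P}}$, put $\alpha_0=\alpha$ and, for $n\ge 0$, $a_n=s(\alpha_n)$; if $\alpha_n=a_n$ the algorithm stops, otherwise $\alpha_{n+1}=\dfrac{1}{\alpha_n-a_n}$. The resulting sequence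 $[a_0,a_1,\ldots]$ is the *continued fraction expansion of type $(K,\mathfrak{P},s)$* of $\alpha$; it is *finite* if the algorithm stops, that is, if $\alpha_n=a_n$ for some $n\ge 0$. The field $K$ has the *$\mathfrak{P}$-adic continued fraction finiteness (CFF) property* if there is a $\mathfrak{P}$-adic floor function $s$ for $K$ such that every $\alpha\in K$ has a finite expansion of type $(K,\mathfrak{P},s)$. **Theorem.** The field $\mathbb{Q}(\sqrt2)$ has the $\mathfrak{P}$-adic CFF property for every nonzero prime ideal $\mathfrak{P}$ of its ring of integers whose residue field $\mathcal{O}_{\mathbb{Q}(\sqrt2)}/\mathfrak{P}$ has odd characteristic. -/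

import Mathlib

open NumberField IsDedekindDomain

/-- The field `ℚ(√2)`, as a subfield of `ℝ`. -/
noncomputable abbrev QSqrt2 : IntermediateField ℚ ℝ :=
  IntermediateField.adjoin ℚ {Real.sqrt 2}

instance QSqrt2.instFiniteDimensional : FiniteDimensional ℚ QSqrt2 := by
  refine IntermediateField.adjoin.finiteDimensional ⟨Polynomial.X ^ 2 - Polynomial.C 2, ?_, ?_⟩
  · exact Polynomial.monic_X_pow_sub_C 2 two_ne_zero
  · simp

instance QSqrt2.instNumberField : NumberField QSqrt2 where

namespace PadicCF

variable (K : Type*) [Field K] [NumberField K]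

/-- A `𝔓`-adic floor function for the number field `K`, i.e. a function `s : K_𝔓 → K` on the
`𝔓`-adic completion of `K` such that
* `|α - s α|_𝔓 < 1` for all `α`;
* `|s α|_w ≤ 1` for all `α` and all non-archimedean places `w ≠ 𝔓` of `K`, so that `s` takes its
  values in the ring of `{𝔓}`-integers of `K`;
* `s 0 = 0` and `s ∘ s = s`;
* `s α = s β` as soon as `|α - β|_𝔓 < 1`.

The non-archimedean places of `K` are the nonzero prime ideals of `𝓞 K`. Absolute values enter only
through comparisons with `1`, so the multiplicative valuations with values in `ℤᵐ⁰` are used. -/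
structure FloorFunction (P : HeightOneSpectrum (𝓞 K)) where
  /-- The underlying function. -/
  toFun : P.adicCompletion K → K
  valuation_sub_lt_one : ∀ α : P.adicCompletion K,
    Valued.v (α - algebraMap K (P.adicCompletion K) (toFun α)) < 1
  valuation_le_one : ∀ (α : P.adicCompletion K) (w : HeightOneSpectrum (𝓞 K)), w ≠ P →
    w.valuation K (toFun α) ≤ 1
  map_zero : toFun 0 = 0
  map_map : ∀ α : P.adicCompletion K,
    toFun (algebraMap K (P.adicCompletion K) (toFun α)) = toFun α
  map_eq_of_valuation_sub_lt_one : ∀ α β : P.adicCompletion K,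
    Valued.v (α - β) < 1 → toFun α = toFun β

variable {K} {P : HeightOneSpectrum (𝓞 K)}

/-- The complete quotients of `α`: `α₀ = α` and `αₙ₊₁ = 1 / (αₙ - aₙ)` with `aₙ = s αₙ`.
The algorithm stops at the first `n` with `αₙ = aₙ`; the terms after that one are meaningless. -/
noncomputable def FloorFunction.completeQuotient (s : FloorFunction K P)
    (α : P.adicCompletion K) : ℕ → P.adicCompletion K
  | 0 => α
  | n + 1 =>
      1 / (s.completeQuotient α n -
        algebraMap K (P.adicCompletion K) (s.toFun (s.completeQuotient α n)))

/-- The partial quotients `aₙ = s αₙ` of `α`. -/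
noncomputable def FloorFunction.partialQuotient (s : FloorFunction K P)
    (α : P.adicCompletion K) (n : ℕ) : K :=
  s.toFun (s.completeQuotient α n)

/-- The continued fraction expansion `[a₀, a₁, …]` of `α` is finite: the algorithm reaches an index
`n` with `αₙ = aₙ` and stops. (The least such `n` is reached without any division by zero.) -/
def FloorFunction.HasFiniteExpansion (s : FloorFunction K P) (α : P.adicCompletion K) : Prop :=
  ∃ n : ℕ, s.completeQuotient α n =
    algebraMap K (P.adicCompletion K) (s.partialQuotient α n)

/-- The type `(K, 𝔓, s)` has the continued fraction finiteness property: every element of `K` has a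
finite expansion. -/
def FloorFunction.CFF (s : FloorFunction K P) : Prop :=
  ∀ α : K, s.HasFiniteExpansion (algebraMap K (P.adicCompletion K) α)

variable (K) (P)

/-- The field `K` has the `𝔓`-adic continued fraction finiteness property: some type `(K, 𝔓, s)`
has it. -/
def HasCFF : Prop :=
  ∃ s : FloorFunction K P, s.CFF

end PadicCF

/-! Let `π` generate `𝔓`, with real embeddings `σ`, `τ` and norm `N = σ π * τ π`. Suppose every
value `a` of a floor function satisfies `(σ a ^ 2 + 2) * (τ a ^ 2 + 2) ≤ c * N ^ 2` with `c < 1`. If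
the expansion of `p / d` never stopped, the Euclidean remainders `X n` would be nonzero, and `X (n +
1) = π ^ n * y` with `y` an algebraic integer. Each Euclidean step multiplies the product over `σ`,
`τ` of the squared lengths of `(X n, X (n + 1))` by at most `c * N ^ 2`. Hence the squared norm of
`y` is at most a constant times `c ^ n`, which tends to `0`, although it is at least `1`
(`FloorFunction.cff_of_bound`).

Such a floor is built from values `π * (z - l)`, with `l` an integer that brings `z` into a fixed
fundamental domain of `ℤ[√2]`. Multiplying `π` by a power of `1 + √2` puts `|σ π / τ π|` between `(1
+ √2)⁻¹` and `1 + √2`; a skew parallelogram then gives the bound with `c = 199 / 200` as soon as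
`|N| ≥ 7` (`reduced_bound`). Odd residue characteristic guarantees `|N| ≥ 7`, because odd norms are
`±1` modulo `8`. -/

namespace PadicCF

open WithZero

/-! ### Floor functions from a bounded system of representatives -/

section General

variable {K : Type*} [Field K] [NumberField K] {P : HeightOneSpectrum (𝓞 K)}

theorem valued_algebraMap (x : K) :
    Valued.v (algebraMap K (P.adicCompletion K) x) = P.valuation K x :=
  HeightOneSpectrum.valuedAdicCompletion_eq_valuation' (v := P) x

theorem valuation_generator {π : 𝓞 K} (hπ : P.asIdeal = Ideal.span {π}) :
    P.valuation K (π : K) = exp (-1 : ℤ) := by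
  have h0 : π ≠ 0 := by
    rintro rfl
    exact P.ne_bot (by simpa using hπ)
  rw [HeightOneSpectrum.valuation_of_algebraMap, P.intValuation_singleton h0 hπ]

theorem coe_generator_ne_zero {π : 𝓞 K} (hπ : P.asIdeal = Ideal.span {π}) : (π : K) ≠ 0 := by
  rw [← (P.valuation K).ne_zero_iff, valuation_generator hπ]
  exact exp_ne_zero

theorem valuation_generator_of_ne {π : 𝓞 K} (hπ : P.asIdeal = Ideal.span {π})
    {w : HeightOneSpectrum (𝓞 K)} (hw : w ≠ P) : w.valuation K (π : K) = 1 := by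
  rw [HeightOneSpectrum.valuation_eq_one_iff_notMem]
  intro hmem
  apply hw
  have hle : P.asIdeal ≤ w.asIdeal := by
    rw [hπ, Ideal.span_singleton_le_iff_mem]
    exact hmem
  exact (HeightOneSpectrum.ext (P.isMaximal.eq_of_le w.isPrime.ne_top hle)).symm

/-- Every element of `K` is congruent to a `{𝔓}`-integer modulo the valuation ring at `𝔓`. -/
theorem exists_valuation_sub_le_one {π : 𝓞 K} (hπ : P.asIdeal = Ideal.span {π}) (x : K) :
    ∃ z : K, P.valuation K (x - z) ≤ 1 ∧
      ∀ w : HeightOneSpectrum (𝓞 K), w ≠ P → w.valuation K z ≤ 1 := by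
  have hvπ := valuation_generator hπ
  have hπ0 := coe_generator_ne_zero hπ
  obtain ⟨m, hm⟩ : ∃ m : ℕ, P.valuation K x ≤ exp (m : ℤ) := by
    by_cases hx : x = 0
    · exact ⟨0, by simp [hx]⟩
    · refine ⟨(log (P.valuation K x)).toNat, ?_⟩
      rw [← exp_log ((P.valuation K).ne_zero_iff.2 hx), exp_le_exp, log_exp]
      exact Int.self_le_toNat _
  have hpow : P.valuation K ((π : K) ^ m) = exp (-(m : ℤ)) := by
    rw [map_pow, hvπ, ← exp_nsmul]
    simp
  have hint : P.valuation K ((π : K) ^ m * x) ≤ 1 := by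
    rw [map_mul, hpow]
    calc exp (-(m : ℤ)) * P.valuation K x ≤ exp (-(m : ℤ)) * exp (m : ℤ) := by gcongr
      _ = 1 := by rw [← exp_add]; simp
  -- Approximating `π ^ m * x` modulo `𝔓 ^ m` leaves an error that is still integral at `𝔓` after
  -- division by `π ^ m`; that division is harmless elsewhere, `π` being a unit there.
  obtain ⟨c, hc⟩ := P.exists_valuation_sub_lt_of_integer hint
    (Units.mk0 (exp (-(m : ℤ))) exp_ne_zero)
  refine ⟨(c : K) / (π : K) ^ m, ?_, fun w hw => ?_⟩
  · have : x - (c : K) / (π : K) ^ m = -((c : K) - (π : K) ^ m * x) / (π : K) ^ m := by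
      field_simp
      ring
    rw [this, map_div₀, Valuation.map_neg, hpow]
    refine div_le_one_of_le₀ hc.le zero_le
  · rw [map_div₀, map_pow, valuation_generator_of_ne hπ hw, one_pow, div_one]
    exact w.valuation_le_one c

/-- The elements of `K` admissible as the floor of `α`, given a bound `B` on their size. -/
def floorCandidates (P : HeightOneSpectrum (𝓞 K)) (B : Set K) (α : P.adicCompletion K) : Set K :=
  {a | Valued.v (α - algebraMap K (P.adicCompletion K) a) < 1 ∧
    (∀ w : HeightOneSpectrum (𝓞 K), w ≠ P → w.valuation K a ≤ 1) ∧ a ∈ B}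

theorem floorCandidates_congr (B : Set K) {α β : P.adicCompletion K} (h : Valued.v (α - β) < 1) :
    floorCandidates P B α = floorCandidates P B β := by
  ext a
  have key : Valued.v (α - algebraMap K (P.adicCompletion K) a) < 1 ↔
      Valued.v (β - algebraMap K (P.adicCompletion K) a) < 1 := by
    constructor <;> intro h'
    · have := Valuation.map_sub_lt _ h' h
      simpa using this
    · have := Valuation.map_add_lt _ h' h
      simpa using this
  simp only [floorCandidates, Set.mem_ofPred_eq, key]

open Classical in
/-- A floor function whose values lie in a set `B` that contains `0` and represents all classes. -/
noncomputable def FloorFunction.ofRepresentatives (B : Set K) (h0 : 0 ∈ B)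
    (hB : ∀ α : P.adicCompletion K, (floorCandidates P B α).Nonempty) : FloorFunction K P :=
  let s : P.adicCompletion K → K := fun α =>
    if (0 : K) ∈ floorCandidates P B α then 0
    else Classical.epsilon fun a => a ∈ floorCandidates P B α
  have hs : ∀ α, s α ∈ floorCandidates P B α := fun α => by
    by_cases h : (0 : K) ∈ floorCandidates P B α
    · simpa only [s, if_pos h] using h
    · simpa only [s, if_neg h] using Classical.epsilon_spec (hB α)
  -- The choice depends only on the candidate set, which is the same for congruent arguments.
  -- Idempotence then follows, since `s α` is congruent to `α`.
  have hcongr : ∀ α β, Valued.v (α - β) < 1 → s α = s β := fun α β h => by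
    simp only [s, floorCandidates_congr B h]
  { toFun := s
    valuation_sub_lt_one := fun α => (hs α).1
    valuation_le_one := fun α => (hs α).2.1
    map_zero := if_pos ⟨by simp, by simp, h0⟩
    map_map := fun α => (hcongr _ _ (hs α).1).symm
    map_eq_of_valuation_sub_lt_one := hcongr }

theorem FloorFunction.ofRepresentatives_mem (B : Set K) (h0 : 0 ∈ B)
    (hB : ∀ α : P.adicCompletion K, (floorCandidates P B α).Nonempty) (α : P.adicCompletion K) :
    (FloorFunction.ofRepresentatives B h0 hB).toFun α ∈ B := by
  simp only [FloorFunction.ofRepresentatives]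
  split_ifs with h
  · exact h0
  · exact (Classical.epsilon_spec (hB α)).2.2

/-- By density of `K` in its completion, only classes of elements of `K` need representatives. -/
theorem floorCandidates_nonempty (B : Set K)
    (hB : ∀ x : K, ∃ a ∈ B, P.valuation K (x - a) < 1 ∧
      ∀ w : HeightOneSpectrum (𝓞 K), w ≠ P → w.valuation K a ≤ 1) (α : P.adicCompletion K) :
    (floorCandidates P B α).Nonempty := by
  have hopen : IsOpen {β : P.adicCompletion K | Valued.v (α - β) < 1} := by
    have hball : IsOpen {γ : P.adicCompletion K | Valued.v γ < 1} := by
      simpa using Valued.isOpen_ball (P.adicCompletion K) 1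
    exact hball.preimage (continuous_const.sub continuous_id)
  obtain ⟨x, hx⟩ := (HeightOneSpectrum.denseRange_algebraMap K P).exists_mem_open hopen
    ⟨α, by simp⟩
  obtain ⟨a, haB, hav, haw⟩ := hB x
  refine ⟨a, ?_, haw, haB⟩
  have h1 : Valued.v (algebraMap K (P.adicCompletion K) x - algebraMap K _ a) < 1 := by
    rw [← map_sub, valued_algebraMap]
    exact hav
  simpa using Valuation.map_add_lt _ hx h1

end General

/-! ### Finiteness from a bound on the partial quotients -/

section Finiteness

variable {K : Type*} [Field K] [NumberField K] {P : HeightOneSpectrum (𝓞 K)}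

/-- The complete quotients of an element of `K`, computed in `K`. -/
noncomputable def FloorFunction.quotientSeq (s : FloorFunction K P) (x : K) : ℕ → K
  | 0 => x
  | n + 1 => 1 / (s.quotientSeq x n - s.toFun (algebraMap K _ (s.quotientSeq x n)))

theorem FloorFunction.completeQuotient_algebraMap (s : FloorFunction K P) (x : K) (n : ℕ) :
    s.completeQuotient (algebraMap K _ x) n = algebraMap K _ (s.quotientSeq x n) := by
  induction n with
  | zero => rfl
  | succ n ih =>
    rw [FloorFunction.completeQuotient, ih, FloorFunction.quotientSeq, map_div₀, map_sub, map_one]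

/-- The remainders of the Euclidean algorithm for `c` and `d` with quotients `a`. -/
def remainderSeq (a : ℕ → K) (c d : K) : ℕ → K
  | 0 => c
  | 1 => d
  | n + 2 => remainderSeq a c d n - a n * remainderSeq a c d (n + 1)

/-- The difference of the two sides is `(a * u + v) ^ 2 + u ^ 2`. -/
theorem sq_add_sq_step (a u v : ℝ) :
    v ^ 2 + (u - a * v) ^ 2 ≤ (a ^ 2 + 2) * (u ^ 2 + v ^ 2) := by
  nlinarith [sq_nonneg (a * u + v), sq_nonneg u]

theorem remainderSeq_bound (a : ℕ → K) (c d : K) (σ τ : K →+* ℝ) (B : ℝ)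
    (ha : ∀ n, (σ (a n) ^ 2 + 2) * (τ (a n) ^ 2 + 2) ≤ B) (n : ℕ) :
    (σ (remainderSeq a c d n) ^ 2 + σ (remainderSeq a c d (n + 1)) ^ 2) *
      (τ (remainderSeq a c d n) ^ 2 + τ (remainderSeq a c d (n + 1)) ^ 2) ≤
      B ^ n * ((σ c ^ 2 + σ d ^ 2) * (τ c ^ 2 + τ d ^ 2)) := by
  have hB : 0 ≤ B := le_trans (by positivity) (ha 0)
  induction n with
  | zero => simp [remainderSeq]
  | succ n ih =>
    set u := remainderSeq a c d n
    set v := remainderSeq a c d (n + 1)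
    have hw : remainderSeq a c d (n + 1 + 1) = u - a n * v := rfl
    rw [hw]
    simp only [map_sub, map_mul]
    calc (σ v ^ 2 + (σ u - σ (a n) * σ v) ^ 2) * (τ v ^ 2 + (τ u - τ (a n) * τ v) ^ 2)
        ≤ ((σ (a n) ^ 2 + 2) * (σ u ^ 2 + σ v ^ 2)) *
          ((τ (a n) ^ 2 + 2) * (τ u ^ 2 + τ v ^ 2)) := by
          gcongr <;> exact sq_add_sq_step _ _ _
      _ = ((σ (a n) ^ 2 + 2) * (τ (a n) ^ 2 + 2)) *
          ((σ u ^ 2 + σ v ^ 2) * (τ u ^ 2 + τ v ^ 2)) := by ring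
      _ ≤ B * (B ^ n * ((σ c ^ 2 + σ d ^ 2) * (τ c ^ 2 + τ d ^ 2))) := by
          gcongr
          exact ha n
      _ = _ := by ring

/-- A type has the finiteness property if its partial quotients are small at two real places
satisfying a product formula bound. -/
theorem FloorFunction.cff_of_bound (s : FloorFunction K P) {π : 𝓞 K}
    (hπ : P.asIdeal = Ideal.span {π}) (σ τ : K →+* ℝ)
    (hN : ∀ y : 𝓞 K, y ≠ 0 → 1 ≤ |σ y * τ y|) {c : ℝ} (hc : c < 1)
    (hs : ∀ α, (σ (s.toFun α) ^ 2 + 2) * (τ (s.toFun α) ^ 2 + 2) ≤ c * (σ π * τ π) ^ 2) :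
    s.CFF := by
  intro x
  by_contra hfin
  simp only [FloorFunction.HasFiniteExpansion, not_exists, FloorFunction.partialQuotient,
    s.completeQuotient_algebraMap] at hfin
  set β := s.quotientSeq x
  set a : ℕ → K := fun n => s.toFun (algebraMap K _ (β n))
  have hne : ∀ n, β n - a n ≠ 0 := fun n h => hfin n (congrArg _ (sub_eq_zero.1 h))
  have hβs : ∀ n, β (n + 1) * (β n - a n) = 1 := fun n => by
    rw [show β (n + 1) = 1 / (β n - a n) from rfl, one_div_mul_cancel (hne n)]
  have hval : ∀ n, P.valuation K (β n - a n) < 1 := fun n => by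
    rw [← valued_algebraMap, map_sub]
    exact s.valuation_sub_lt_one _
  have hvπ := valuation_generator hπ
  have hπ0 := coe_generator_ne_zero hπ
  obtain ⟨p, d, hd, hx⟩ := IsFractionRing.div_surjective (A := 𝓞 K) x
  have hd0 : d ≠ 0 := nonZeroDivisors.ne_zero hd
  have hd0' : (d : K) ≠ 0 := by simpa using hd0
  set X := remainderSeq a (p : K) (d : K) with hX
  have hrec : ∀ n, X (n + 2) = X n - a n * X (n + 1) := fun n => rfl
  have hXβ : ∀ n, X n = β n * X (n + 1) ∧ X (n + 1) ≠ 0 := by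
    intro n
    induction n with
    | zero =>
      refine ⟨?_, hd0'⟩
      change (p : K) = x * (d : K)
      rw [← hx, div_mul_cancel₀ _ hd0']
    | succ n ih =>
      have h2 : X (n + 2) = X (n + 1) * (β n - a n) := by rw [hrec, ih.1]; ring
      refine ⟨?_, ?_⟩
      · change X (n + 1) = β (n + 1) * X (n + 2)
        rw [h2, mul_left_comm, hβs, mul_one]
      · change X (n + 2) ≠ 0
        rw [h2]
        exact mul_ne_zero ih.2 (hne n)
  -- Each remainder is the previous one times `β n - a n`, which has positive order at `𝔓`.
  have hXP : ∀ n : ℕ, P.valuation K (X (n + 1)) ≤ exp (-(n : ℤ)) := by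
    intro n
    induction n with
    | zero =>
      rw [Nat.cast_zero, neg_zero, exp_zero]
      exact P.valuation_le_one d
    | succ n ih =>
      have h2 : X (n + 1 + 1) = X (n + 1) * (β n - a n) := by
        rw [hrec, (hXβ n).1]; ring
      have h3 : P.valuation K (β n - a n) ≤ exp (-1 : ℤ) := by
        have h4 := hval n
        rw [← exp_log ((P.valuation K).ne_zero_iff.2 (hne n)), ← exp_zero, exp_lt_exp] at h4
        rw [← exp_log ((P.valuation K).ne_zero_iff.2 (hne n)), exp_le_exp]
        omega
      rw [h2, map_mul]
      calc _ ≤ exp (-(n : ℤ)) * exp (-1 : ℤ) := by gcongr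
        _ = _ := by rw [← exp_add]; congr 1; push_cast; ring
  have hXw : ∀ w : HeightOneSpectrum (𝓞 K), w ≠ P → ∀ n : ℕ,
      w.valuation K (X n) ≤ 1 ∧ w.valuation K (X (n + 1)) ≤ 1 := by
    intro w hw n
    induction n with
    | zero => exact ⟨w.valuation_le_one p, w.valuation_le_one d⟩
    | succ n ih =>
      refine ⟨ih.2, ?_⟩
      change w.valuation K (X (n + 2)) ≤ 1
      rw [hrec]
      refine Valuation.map_sub_le _ ih.1 ?_
      rw [map_mul]
      exact mul_le_one' (s.valuation_le_one _ w hw) ih.2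
  have hXpow : ∀ n : ℕ, ∃ y : 𝓞 K, y ≠ 0 ∧ X (n + 1) = (π : K) ^ n * (y : K) := by
    intro n
    have hmem := HeightOneSpectrum.mem_integers_of_valuation_le_one (R := 𝓞 K) K
      (X (n + 1) / (π : K) ^ n) (fun w => by
        rw [map_div₀, map_pow]
        by_cases hw : w = P
        · rw [hw, hvπ, ← exp_nsmul]
          refine div_le_one_of_le₀ ?_ zero_le
          simpa using hXP n
        · rw [valuation_generator_of_ne hπ hw, one_pow, div_one]
          exact (hXw w hw n).2)
    obtain ⟨y, hy⟩ := hmem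
    have hy' : X (n + 1) = (π : K) ^ n * (y : K) := by
      rw [show (y : K) = _ from hy]
      field_simp
    refine ⟨y, ?_, hy'⟩
    rintro rfl
    exact (hXβ n).2 (by rw [hy']; simp)
  set q := (σ π * τ π) ^ 2 with hq
  set C := (σ (p : K) ^ 2 + σ (d : K) ^ 2) * (τ (p : K) ^ 2 + τ (d : K) ^ 2) with hC
  have hπ0' : π ≠ 0 := by
    rintro rfl
    simp at hπ0
  have hq1 : 0 < q := by
    have h1 := hN π hπ0'
    have h2 : σ π * τ π ≠ 0 := by
      intro h
      rw [h] at h1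
      norm_num at h1
    positivity
  have hc0 : 0 ≤ c := by
    by_contra hneg
    push Not at hneg
    have := hs 0
    have h2 : c * q < 0 := mul_neg_of_neg_of_pos hneg hq1
    have h3 : 0 ≤ (σ (s.toFun 0) ^ 2 + 2) * (τ (s.toFun 0) ^ 2 + 2) := by positivity
    linarith
  have hlower : ∀ n : ℕ, 1 ≤ c ^ n * C := by
    intro n
    obtain ⟨y, hy0, hy⟩ := hXpow n
    have h1 := remainderSeq_bound a (p : K) (d : K) σ τ (c * q) (fun m => hs _) n
    rw [← hX, ← hC] at h1
    have h2 : q ^ n * (σ y * τ y) ^ 2 ≤ (c * q) ^ n * C := by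
      refine le_trans ?_ h1
      calc q ^ n * (σ y * τ y) ^ 2 = σ (X (n + 1)) ^ 2 * τ (X (n + 1)) ^ 2 := by
            rw [hy, hq]
            simp only [map_mul, map_pow]
            ring
        _ ≤ _ := by
            gcongr <;> exact le_add_of_nonneg_left (sq_nonneg _)
    have h3 : 1 ≤ (σ y * τ y) ^ 2 := by
      rw [one_le_sq_iff_one_le_abs]
      exact hN y hy0
    have h4 : 0 < q ^ n := by positivity
    rw [mul_pow c, mul_comm (c ^ n), mul_assoc] at h2
    exact h3.trans (le_of_mul_le_mul_left h2 h4)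
  have hlim := (tendsto_pow_atTop_nhds_zero_of_lt_one hc0 hc).mul_const C
  rw [zero_mul] at hlim
  have := ge_of_tendsto' hlim hlower
  linarith

/-- If `z` is a `{𝔓}`-integer approximating `x / π` up to a `𝔓`-integral error, every `π * (z - l)`
is an admissible floor of `x`; `l` is free to make it small. `h0` says that `0` meets the size
bound. -/
theorem hasCFF_of_bound {π : 𝓞 K} (hπ : P.asIdeal = Ideal.span {π}) (σ τ : K →+* ℝ)
    (hN : ∀ y : 𝓞 K, y ≠ 0 → 1 ≤ |σ y * τ y|) {c : ℝ} (hc : c < 1)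
    (h0 : 4 ≤ c * (σ π * τ π) ^ 2)
    (hred : ∀ z : K, ∃ l : 𝓞 K,
      (σ (π * (z - l)) ^ 2 + 2) * (τ (π * (z - l)) ^ 2 + 2) ≤ c * (σ π * τ π) ^ 2) :
    HasCFF K P := by
  set B : Set K := {a | (σ a ^ 2 + 2) * (τ a ^ 2 + 2) ≤ c * (σ π * τ π) ^ 2}
  have hvπ := valuation_generator hπ
  have hπ0 := coe_generator_ne_zero hπ
  have hB0 : (0 : K) ∈ B := by
    change (σ 0 ^ 2 + 2) * (τ 0 ^ 2 + 2) ≤ c * (σ π * τ π) ^ 2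
    norm_num [h0]
  have hB : ∀ α, (floorCandidates P B α).Nonempty := floorCandidates_nonempty B fun x => by
    obtain ⟨z, hz, hzw⟩ := exists_valuation_sub_le_one hπ (x / π)
    obtain ⟨l, hl⟩ := hred z
    refine ⟨π * (z - l), hl, ?_, fun w hw => ?_⟩
    · have : x - π * (z - l) = π * ((x / π - z) + l) := by
        field_simp
        ring
      rw [this, map_mul, hvπ]
      calc _ ≤ exp (-1 : ℤ) * 1 := by
            gcongr
            exact Valuation.map_add_le _ hz (P.valuation_le_one l)
        _ < 1 := by
            rw [mul_one, ← exp_zero, exp_lt_exp]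
            norm_num
    · rw [map_mul, valuation_generator_of_ne hπ hw, one_mul]
      exact Valuation.map_sub_le _ (hzw w hw) (w.valuation_le_one l)
  exact ⟨.ofRepresentatives B hB0 hB,
    FloorFunction.cff_of_bound _ hπ σ τ hN hc (FloorFunction.ofRepresentatives_mem B hB0 hB)⟩

end Finiteness

end PadicCF

/-! ### Arithmetic of `ℚ(√2)` and its two real embeddings -/

namespace QSqrt2

/-- `√2` as an element of `ℚ(√2)`. -/
noncomputable def sqrtTwo : QSqrt2 := IntermediateField.AdjoinSimple.gen ℚ (Real.sqrt 2)

theorem coe_sqrtTwo : (sqrtTwo : ℝ) = Real.sqrt 2 := rfl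

theorem sqrtTwo_sq : sqrtTwo ^ 2 = 2 := by
  apply Subtype.ext
  rw [SubmonoidClass.coe_pow, coe_sqrtTwo, Real.sq_sqrt zero_le_two]
  rfl

theorem isIntegral_real_sqrt_two : IsIntegral ℚ (Real.sqrt 2) :=
  ⟨Polynomial.X ^ 2 - Polynomial.C 2, Polynomial.monic_X_pow_sub_C 2 two_ne_zero, by simp⟩

theorem exists_coords (x : QSqrt2) : ∃ u v : ℚ, x = u + v * sqrtTwo := by
  obtain ⟨x, hx⟩ := x
  suffices h : ∃ u v : ℚ, x = u + v * Real.sqrt 2 by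
    obtain ⟨u, v, h⟩ := h
    refine ⟨u, v, Subtype.ext ?_⟩
    push_cast
    exact h
  rw [← IntermediateField.mem_toSubalgebra,
    IntermediateField.adjoin_simple_toSubalgebra_of_isAlgebraic
      isIntegral_real_sqrt_two.isAlgebraic] at hx
  induction hx using Algebra.adjoin_induction with
  | mem x hx => exact ⟨0, 1, by simpa using hx⟩
  | algebraMap q => exact ⟨q, 0, by simp⟩
  | add x y _ _ hx hy =>
    obtain ⟨u, v, rfl⟩ := hx
    obtain ⟨u', v', rfl⟩ := hy
    exact ⟨u + u', v + v', by push_cast; ring⟩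
  | mul x y _ _ hx hy =>
    obtain ⟨u, v, rfl⟩ := hx
    obtain ⟨u', v', rfl⟩ := hy
    refine ⟨u * u' + 2 * v * v', u * v' + v * u', ?_⟩
    push_cast
    linear_combination (v * v' : ℝ) * Real.sq_sqrt (zero_le_two (α := ℝ))

theorem irreducible_X_sq_sub_two :
    Irreducible (Polynomial.X ^ 2 - Polynomial.C 2 : Polynomial ℚ) := by
  refine X_pow_sub_C_irreducible_of_prime Nat.prime_two fun b hb => ?_
  apply irrational_sqrt_two
  refine ⟨|b|, ?_⟩
  have hb' : (b : ℝ) ^ 2 = 2 := by exact_mod_cast hb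
  rw [← hb', Real.sqrt_sq_eq_abs, Rat.cast_abs]

theorem minpoly_real_sqrt_two :
    minpoly ℚ (Real.sqrt 2) = Polynomial.X ^ 2 - Polynomial.C 2 :=
  (minpoly.eq_of_irreducible_of_monic irreducible_X_sq_sub_two (by simp)
    (Polynomial.monic_X_pow_sub_C 2 two_ne_zero)).symm

theorem exists_embedding {r : ℝ} (hr : r ^ 2 = 2) :
    ∃ φ : QSqrt2 →+* ℝ, φ sqrtTwo = r := by
  have hmem : r ∈ (minpoly ℚ (Real.sqrt 2)).aroots ℝ := by
    rw [minpoly_real_sqrt_two, Polynomial.mem_aroots]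
    exact ⟨irreducible_X_sq_sub_two.ne_zero, by simp [hr]⟩
  refine ⟨((IntermediateField.algHomAdjoinIntegralEquiv ℚ isIntegral_real_sqrt_two).symm
    ⟨r, hmem⟩ : QSqrt2 →ₐ[ℚ] ℝ), ?_⟩
  exact IntermediateField.algHomAdjoinIntegralEquiv_symm_apply_gen ℚ isIntegral_real_sqrt_two
    ⟨r, hmem⟩

theorem isIntegral_sqrtTwo : IsIntegral ℤ sqrtTwo :=
  ⟨Polynomial.X ^ 2 - Polynomial.C 2, Polynomial.monic_X_pow_sub_C 2 two_ne_zero, by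
    simp [sqrtTwo_sq]⟩

/-- `√2` as an algebraic integer. -/
noncomputable def intSqrtTwo : 𝓞 QSqrt2 := ⟨sqrtTwo, isIntegral_sqrtTwo⟩

theorem coe_intSqrtTwo : (intSqrtTwo : QSqrt2) = sqrtTwo := rfl

/-- `σ` and `τ` are the two real embeddings of `ℚ(√2)`. -/
structure IsConjPair (σ τ : QSqrt2 →+* ℝ) : Prop where
  sq : σ sqrtTwo ^ 2 = 2
  neg : τ sqrtTwo = -σ sqrtTwo

theorem exists_isConjPair : ∃ σ τ : QSqrt2 →+* ℝ, IsConjPair σ τ := by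
  obtain ⟨σ, hσ⟩ := exists_embedding (Real.sq_sqrt (zero_le_two (α := ℝ)))
  obtain ⟨τ, hτ⟩ := exists_embedding (r := -Real.sqrt 2) (by simp)
  exact ⟨σ, τ, by simp [hσ], by rw [hσ, hτ]⟩

namespace IsConjPair

variable {σ τ : QSqrt2 →+* ℝ}

theorem symm (h : IsConjPair σ τ) : IsConjPair τ σ := ⟨by rw [h.neg, neg_sq, h.sq], by rw [h.neg, neg_neg]⟩

theorem map_mul_map (h : IsConjPair σ τ) (u v : ℚ) :
    σ (u + v * sqrtTwo) * τ (u + v * sqrtTwo) = ((u ^ 2 - 2 * v ^ 2 : ℚ) : ℝ) := by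
  simp only [map_add, map_mul, map_ratCast, h.neg]
  push_cast
  linear_combination (-(v : ℝ) ^ 2) * h.sq

end IsConjPair

/-- A rational number that is integral over `ℤ` as a real number is an integer. -/
theorem exists_int_of_isIntegral {q : ℚ} (hq : IsIntegral ℤ (q : ℝ)) : ∃ n : ℤ, q = n := by
  have h1 : IsIntegral ℤ q :=
    (isIntegral_algHom_iff (IsScalarTower.toAlgHom ℤ ℚ ℝ) (algebraMap ℚ ℝ).injective).1 hq
  obtain ⟨n, hn⟩ := IsIntegrallyClosed.isIntegral_iff.1 h1
  exact ⟨n, by simpa using hn.symm⟩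

theorem exists_int_coords (x : 𝓞 QSqrt2) : ∃ a b : ℤ, (x : QSqrt2) = a + b * sqrtTwo := by
  obtain ⟨σ, τ, h⟩ := exists_isConjPair
  obtain ⟨u, v, hx⟩ := exists_coords x
  have hσ : IsIntegral ℤ (σ x) := x.isIntegral_coe.map (σ.toIntAlgHom)
  have hτ : IsIntegral ℤ (τ x) := x.isIntegral_coe.map (τ.toIntAlgHom)
  -- The trace `2 * u` and the norm are integers, which forces `4 * v` to be one; parity then
  -- removes the denominators.
  obtain ⟨t, ht⟩ : ∃ t : ℤ, 2 * u = t := by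
    refine exists_int_of_isIntegral ?_
    have hsum : ((2 * u : ℚ) : ℝ) = σ x + τ x := by
      rw [hx]
      simp only [map_add, map_mul, map_ratCast, h.neg]
      push_cast
      ring
    rw [hsum]
    exact hσ.add hτ
  obtain ⟨n, hn⟩ : ∃ n : ℤ, u ^ 2 - 2 * v ^ 2 = n := by
    refine exists_int_of_isIntegral ?_
    rw [← h.map_mul_map, ← hx]
    exact hσ.mul hτ
  obtain ⟨w, hw⟩ : ∃ w : ℤ, 4 * v = w := by
    refine exists_int_of_isIntegral (IsIntegral.of_pow (n := 2) two_pos ?_)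
    have : (((4 * v : ℚ) : ℝ)) ^ 2 = ((2 * (t ^ 2 - 4 * n) : ℤ) : ℝ) := by
      have : (4 * v) ^ 2 = ((2 * (t ^ 2 - 4 * n) : ℤ) : ℚ) := by
        push_cast
        rw [← ht, ← hn]
        ring
      exact_mod_cast this
    rw [this]
    exact isIntegral_algebraMap (R := ℤ) (A := ℝ)
  have key : w ^ 2 = 2 * (t ^ 2 - 4 * n) := by
    have : (w : ℚ) ^ 2 = 2 * (t ^ 2 - 4 * n) := by
      rw [← ht, ← hn, ← hw]
      ring
    exact_mod_cast this
  have even_of_sq : ∀ m k : ℤ, m ^ 2 = 2 * k → ∃ l, m = 2 * l := fun m k hmk =>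
    Int.prime_two.dvd_of_dvd_pow ⟨k, hmk⟩
  obtain ⟨w₁, rfl⟩ := even_of_sq _ _ key
  obtain ⟨a, rfl⟩ := even_of_sq t (w₁ ^ 2 + 2 * n) (by linarith)
  obtain ⟨b, rfl⟩ := even_of_sq w₁ (a ^ 2 - n) (by linarith)
  refine ⟨a, b, ?_⟩
  have hu : u = a := by push_cast at ht; linarith
  have hv : v = b := by push_cast at hw; linarith
  rw [hx, hu, hv]
  simp

namespace IsConjPair

variable {σ τ : QSqrt2 →+* ℝ}

theorem map_mul_map_int (h : IsConjPair σ τ) (a b : ℤ) :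
    σ (a + b * sqrtTwo) * τ (a + b * sqrtTwo) = ((a ^ 2 - 2 * b ^ 2 : ℤ) : ℝ) := by
  have := h.map_mul_map a b
  push_cast at this ⊢
  exact this

theorem exists_nat_eq_abs (h : IsConjPair σ τ) (y : 𝓞 QSqrt2) : ∃ n : ℕ, |σ y * τ y| = n := by
  obtain ⟨a, b, hy⟩ := exists_int_coords y
  refine ⟨(a ^ 2 - 2 * b ^ 2).natAbs, ?_⟩
  rw [hy, h.map_mul_map_int, Nat.cast_natAbs, Int.cast_abs]

theorem one_le_abs (h : IsConjPair σ τ) (y : 𝓞 QSqrt2) (hy : y ≠ 0) : 1 ≤ |σ y * τ y| := by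
  obtain ⟨n, hn⟩ := h.exists_nat_eq_abs y
  have h0 : |σ y * τ y| ≠ 0 := by simpa using hy
  rw [hn] at h0 ⊢
  exact_mod_cast Nat.one_le_iff_ne_zero.2 (by exact_mod_cast h0)

/-- A system of representatives of `ℚ(√2)` modulo its ring of integers, skewed so that it is small
simultaneously for all quadratic forms `ρ σ(z)² + ρ⁻¹ τ(z)²` with `1 ≤ ρ ≤ 1 + √2`. -/
theorem exists_reduction (h : IsConjPair σ τ) (z : QSqrt2) : ∃ (l : 𝓞 QSqrt2) (x y : ℝ),
    σ (z - l) = x + y * √2 ∧ τ (z - l) = x - y * √2 ∧ |y| ≤ 1 / 2 ∧ |x + y / 2| ≤ 1 / 2 := by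
  obtain ⟨u, v, rfl⟩ := exists_coords z
  -- The skew domain is not symmetric under conjugation, so the coordinates follow the sign of `σ
  -- sqrtTwo`; this lets `σ` and `τ` be swapped later.
  obtain ⟨e, he, hσ⟩ : ∃ e : ℤ, e * e = 1 ∧ σ sqrtTwo = e * √2 := by
    have := h.sq
    rw [← Real.sq_sqrt (zero_le_two (α := ℝ)), sq_eq_sq_iff_eq_or_eq_neg] at this
    rcases this with h1 | h1
    · exact ⟨1, by norm_num, by rw [h1]; simp⟩
    · exact ⟨-1, by norm_num, by rw [h1]; simp⟩
  have he' : (e : ℝ) * e = 1 := by exact_mod_cast he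
  set b : ℤ := round ((e : ℝ) * v) with hb
  set y : ℝ := e * v - b with hy
  set a : ℤ := round ((u : ℝ) + y / 2) with ha
  have hcoe : (((a : 𝓞 QSqrt2) + ((e * b : ℤ) : 𝓞 QSqrt2) * intSqrtTwo : 𝓞 QSqrt2) : QSqrt2) =
      a + (e * b : ℤ) * sqrtTwo := by
    simp only [← coe_intSqrtTwo, RingOfIntegers.coe_eq_algebraMap, map_add, map_mul, map_intCast]
  refine ⟨a + (e * b : ℤ) * intSqrtTwo, u - a, y, ?_, ?_, abs_sub_round _, ?_⟩
  · rw [hcoe]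
    simp only [map_sub, map_add, map_mul, map_ratCast, map_intCast, hσ]
    push_cast
    linear_combination (-(b : ℝ) * √2) * he'
  · rw [hcoe]
    simp only [map_sub, map_add, map_mul, map_ratCast, map_intCast, h.neg, hσ]
    push_cast
    linear_combination ((b : ℝ) * √2) * he'
  · have := abs_sub_round ((u : ℝ) + y / 2)
    rwa [← ha, add_sub_right_comm] at this

end IsConjPair

/-! ### Estimates on the skew fundamental domain -/

theorem abs_norm_le_half {x y : ℝ} (hy : |y| ≤ 1 / 2) (hx : |x + y / 2| ≤ 1 / 2) :
    |(x + y * √2) * (x - y * √2)| ≤ 1 / 2 := by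
  have hs : √2 ^ 2 = (2 : ℝ) := Real.sq_sqrt zero_le_two
  have hN : (x + y * √2) * (x - y * √2) = x ^ 2 - 2 * y ^ 2 := by
    linear_combination (-y ^ 2) * hs
  rw [hN]
  rw [abs_le] at hy hx ⊢
  obtain ⟨hy1, hy2⟩ := hy
  obtain ⟨hx1, hx2⟩ := hx
  constructor
  · nlinarith [sq_nonneg x]
  -- The maximum of `x ^ 2 - 2 * y ^ 2` on the domain is `2 / 7`, at `|y| = 1 / 7`.
  · rcases le_total 0 y with h | h
    · nlinarith [mul_nonneg (sub_nonneg.2 hx2) (by linarith : (0 : ℝ) ≤ 1 / 2 + (x + y / 2)),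
        sq_nonneg (y - 1 / 7), mul_nonneg h (by linarith : (0 : ℝ) ≤ 1 / 2 + (x + y / 2))]
    · nlinarith [mul_nonneg (sub_nonneg.2 hx2) (by linarith : (0 : ℝ) ≤ 1 / 2 + (x + y / 2)),
        sq_nonneg (y + 1 / 7),
        mul_nonneg (neg_nonneg.2 h) (by linarith : (0 : ℝ) ≤ 1 / 2 - (x + y / 2))]

/-- With `ρ = p / t` the claim bounds `ρ * g + f / ρ`, which is convex in `ρ`, so the endpoints `ρ =
1` (`hE1`) and `ρ = 1 + √2` (`hE2`) suffice. The second is the tight one: `13 / 8 * √2 < 23 / 10`.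
-/
theorem sq_add_sq_le {x y p t : ℝ} (hy : |y| ≤ 1 / 2) (hx : |x + y / 2| ≤ 1 / 2)
    (ht : 0 < t) (htp : t ≤ p) (hpt : p ≤ (1 + √2) * t) :
    p ^ 2 * (x + y * √2) ^ 2 + t ^ 2 * (x - y * √2) ^ 2 ≤ 23 / 10 * (p * t) := by
  have hs : √2 ^ 2 = (2 : ℝ) := Real.sq_sqrt zero_le_two
  have hs0 : 0 < √2 := by positivity
  have hs1 : √2 ≤ 1.415 := by
    rw [Real.sqrt_le_left (by norm_num)]
    norm_num
  have hy2 : y ^ 2 ≤ 1 / 4 := by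
    have := sq_le_sq' (abs_le.1 hy).1 (abs_le.1 hy).2
    linarith
  have hx2 : (x + y / 2) ^ 2 ≤ 1 / 4 := by
    have := sq_le_sq' (abs_le.1 hx).1 (abs_le.1 hx).2
    linarith
  have hxy : -(1 / 4) ≤ (x + y / 2) * y := by
    nlinarith [sq_nonneg (x + y / 2 + y)]
  have hp : 0 < p := ht.trans_le htp
  generalize √2 = s at *
  set g := (x + y * s) ^ 2 with hg
  set f := (x - y * s) ^ 2 with hf
  have hE1 : g + f ≤ 23 / 10 := by
    have : g + f = 2 * (x + y / 2) ^ 2 - 2 * ((x + y / 2) * y) + 9 / 2 * y ^ 2 := by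
      rw [hg, hf]
      linear_combination 2 * y ^ 2 * hs
    linarith
  have hE2 : (1 + s) * g + (s - 1) * f ≤ 23 / 10 := by
    have : (1 + s) * g + (s - 1) * f =
        2 * s * ((x + y / 2) ^ 2 + (x + y / 2) * y + 5 / 4 * y ^ 2) := by
      rw [hg, hf]
      linear_combination (2 * y ^ 2 * s) * hs
    have hT : (x + y / 2) ^ 2 + (x + y / 2) * y + 5 / 4 * y ^ 2 ≤ 13 / 16 := by
      nlinarith [sq_nonneg (x + y / 2 - y)]
    rw [this]
    linarith [mul_le_mul_of_nonneg_left hT hs0.le]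
  have hf0 : 0 ≤ f := sq_nonneg _
  -- The chord bound for `1 / ρ` on `[1, 1 + √2]`, with denominators cleared.
  have h1 : s * t ^ 2 ≤ p * (2 * t - (2 - s) * p) := by
    have h2 : (2 - s) * p ≤ s * t := by nlinarith
    nlinarith [mul_nonneg (sub_nonneg.2 htp) (sub_nonneg.2 h2)]
  have h2 : (s * t) * (p ^ 2 * g + t ^ 2 * f) ≤ (s * t) * (23 / 10 * (p * t)) := by
    calc (s * t) * (p ^ 2 * g + t ^ 2 * f)
        = p * t * (s * t + s * (p - t)) * g + t * f * (s * t ^ 2) := by ring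
      _ ≤ p * t * (s * t + s * (p - t)) * g + t * f * (p * (2 * t - (2 - s) * p)) := by gcongr
      _ = p * t * (((1 + s) * t - p) * (g + f) + (p - t) * ((1 + s) * g + (s - 1) * f)) := by ring
      _ ≤ p * t * (((1 + s) * t - p) * (23 / 10) + (p - t) * (23 / 10)) := by
          gcongr
      _ = _ := by ring
  exact le_of_mul_le_mul_left h2 (by positivity)

/-- With `q = p * t`, expanding bounds the left side by `q ^ 2 / 4 + 23 / 5 * q + 4`, which at `q =
7` is `48.45`, just below `199 / 200 * 49`. -/
theorem reduced_bound {x y p t : ℝ} (hy : |y| ≤ 1 / 2) (hx : |x + y / 2| ≤ 1 / 2)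
    (ht : 0 < t) (htp : t ≤ p) (hpt : p ≤ (1 + √2) * t) (hq : 7 ≤ p * t) :
    (p ^ 2 * (x + y * √2) ^ 2 + 2) * (t ^ 2 * (x - y * √2) ^ 2 + 2) ≤
      199 / 200 * (p * t) ^ 2 := by
  have h1 := sq_add_sq_le hy hx ht htp hpt
  have h2 : ((x + y * √2) * (x - y * √2)) ^ 2 ≤ 1 / 4 := by
    have h3 := abs_le.1 (abs_norm_le_half hy hx)
    have := sq_le_sq' h3.1 h3.2
    linarith
  have h3 : (p * t) ^ 2 * ((x + y * √2) * (x - y * √2)) ^ 2 ≤ (p * t) ^ 2 * (1 / 4) := by gcongr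
  nlinarith

/-! ### Generators of prime ideals: existence, size and balancing -/

variable {P : HeightOneSpectrum (𝓞 QSqrt2)}

/-- The ring is norm-Euclidean: reduction modulo an element of least norm at least halves the norm.
-/
theorem exists_generator (P : HeightOneSpectrum (𝓞 QSqrt2)) :
    ∃ π : 𝓞 QSqrt2, P.asIdeal = Ideal.span {π} := by
  classical
  obtain ⟨σ, τ, h⟩ := exists_isConjPair
  have hex : ∃ n : ℕ, ∃ y ∈ P.asIdeal, y ≠ 0 ∧ |σ y * τ y| = n := by
    obtain ⟨y, hy, hy0⟩ := Submodule.exists_mem_ne_zero_of_ne_bot P.ne_bot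
    obtain ⟨n, hn⟩ := h.exists_nat_eq_abs y
    exact ⟨n, y, hy, hy0, hn⟩
  obtain ⟨π, hπ, hπ0, hn⟩ := Nat.find_spec hex
  refine ⟨π, le_antisymm (fun x hx => ?_) ((Ideal.span_singleton_le_iff_mem _).2 hπ)⟩
  have hπK : (π : QSqrt2) ≠ 0 := by simpa using hπ0
  obtain ⟨l, u, v, hσ, hτ, hv, hu⟩ := h.exists_reduction ((x : QSqrt2) / π)
  have hmem : x - l * π ∈ P.asIdeal := sub_mem hx (P.asIdeal.mul_mem_left _ hπ)
  have hcoe : ((x - l * π : 𝓞 QSqrt2) : QSqrt2) = ((x : QSqrt2) / π - l) * π := by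
    simp only [RingOfIntegers.coe_eq_algebraMap, map_sub, map_mul] at hπK ⊢
    field_simp
  by_contra hx'
  have hne : x - l * π ≠ 0 := fun h0 =>
    hx' (Ideal.mem_span_singleton'.2 ⟨l, (sub_eq_zero.1 h0).symm⟩)
  obtain ⟨m, hm⟩ := h.exists_nat_eq_abs (x - l * π)
  have hle : Nat.find hex ≤ m := Nat.find_min' hex ⟨_, hmem, hne, hm⟩
  have hlt : (m : ℝ) ≤ 1 / 2 * (Nat.find hex : ℕ) := by
    rw [← hm, ← hn, hcoe, map_mul, map_mul, mul_mul_mul_comm, abs_mul, hσ, hτ]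
    gcongr
    exact abs_norm_le_half hv hu
  have hpos : (1 : ℝ) ≤ (Nat.find hex : ℕ) := hn ▸ h.one_le_abs π hπ0
  have hle' : ((Nat.find hex : ℕ) : ℝ) ≤ m := by exact_mod_cast hle
  linarith

theorem intSqrtTwo_mul_self : intSqrtTwo * intSqrtTwo = 2 := by
  apply RingOfIntegers.coe_injective
  rw [map_mul, ← RingOfIntegers.coe_eq_algebraMap, coe_intSqrtTwo, ← sq, sqrtTwo_sq, map_ofNat]

/-- The fundamental unit `1 + √2`. -/
noncomputable def fundUnit : (𝓞 QSqrt2)ˣ where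
  val := 1 + intSqrtTwo
  inv := intSqrtTwo - 1
  val_inv := by linear_combination intSqrtTwo_mul_self
  inv_val := by linear_combination intSqrtTwo_mul_self

theorem two_notMem (hP : Odd (ringChar (𝓞 QSqrt2 ⧸ P.asIdeal))) : (2 : 𝓞 QSqrt2) ∉ P.asIdeal := by
  intro hmem
  have h2 : ((2 : ℕ) : 𝓞 QSqrt2 ⧸ P.asIdeal) = 0 := by
    rw [Nat.cast_ofNat, ← map_ofNat (Ideal.Quotient.mk P.asIdeal) 2]
    exact Ideal.Quotient.eq_zero_iff_mem.2 hmem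
  rw [ringChar.spec, Nat.dvd_prime Nat.prime_two] at h2
  rcases h2 with h1 | h1
  · have h3 : ((1 : ℕ) : 𝓞 QSqrt2 ⧸ P.asIdeal) = 0 := by
      rw [ringChar.spec, h1]
    rw [Nat.cast_one, ← map_one (Ideal.Quotient.mk P.asIdeal), Ideal.Quotient.eq_zero_iff_mem] at h3
    exact P.isPrime.ne_top ((Ideal.eq_top_iff_one _).2 h3)
  · rw [h1] at hP
    exact absurd hP (by decide)

/-- Writing `π = a + b√2`, an even `a` would make `√2` divide `π`, hence lie in `𝔓` or be a unit.
For odd `a` the norm is `±1` modulo `8`, and `±1` itself would make `π` a unit. -/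
theorem seven_le_abs_norm (hP : Odd (ringChar (𝓞 QSqrt2 ⧸ P.asIdeal))) {π : 𝓞 QSqrt2}
    (hπ : P.asIdeal = Ideal.span {π}) {σ τ : QSqrt2 →+* ℝ} (h : IsConjPair σ τ) :
    7 ≤ |σ π * τ π| := by
  have h2 := two_notMem hP
  have hmem : π ∈ P.asIdeal := hπ ▸ Ideal.mem_span_singleton_self π
  have hprime := P.isPrime
  have hs : intSqrtTwo ∉ P.asIdeal := fun hs =>
    h2 (intSqrtTwo_mul_self ▸ P.asIdeal.mul_mem_left _ hs)
  obtain ⟨a, b, hab⟩ := exists_int_coords π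
  have hab' : π = (a : 𝓞 QSqrt2) + b * intSqrtTwo := by
    apply RingOfIntegers.coe_injective
    simpa only [← coe_intSqrtTwo, RingOfIntegers.coe_eq_algebraMap, map_add, map_mul,
      map_intCast] using hab
  have hodd : ¬ Even a := by
    rintro ⟨c, rfl⟩
    have hfac : π = intSqrtTwo * (b + c * intSqrtTwo) := by
      rw [hab']
      push_cast
      linear_combination (-(c : 𝓞 QSqrt2)) * intSqrtTwo_mul_self
    have hk := (hprime.mem_or_mem (hfac ▸ hmem)).resolve_left hs
    rw [hπ, Ideal.mem_span_singleton'] at hk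
    obtain ⟨t, ht⟩ := hk
    have hπ0 : π ≠ 0 := by
      rintro rfl
      exact P.ne_bot (by simpa using hπ)
    have h1 : intSqrtTwo * t = 1 := by
      apply mul_right_cancel₀ hπ0
      rw [mul_assoc, ht, ← hfac, one_mul]
    have ht0 : t ≠ 0 := by
      rintro rfl
      simp at h1
    have hN := congrArg (fun y : 𝓞 QSqrt2 => |σ y * τ y|) h1
    simp only [map_mul, map_one, mul_one, abs_one] at hN
    simp only [← RingOfIntegers.coe_eq_algebraMap, coe_intSqrtTwo, h.neg] at hN
    have hs2 : |σ sqrtTwo * -σ sqrtTwo| = 2 := by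
      rw [mul_neg, abs_neg, ← sq, h.sq, abs_two]
    rw [mul_mul_mul_comm, abs_mul, hs2] at hN
    linarith [h.one_le_abs t ht0]
  have hunit : (a ^ 2 - 2 * b ^ 2).natAbs ≠ 1 := by
    intro h1
    have hnorm : ((a ^ 2 - 2 * b ^ 2 : ℤ) : 𝓞 QSqrt2) ∈ P.asIdeal := by
      have : ((a ^ 2 - 2 * b ^ 2 : ℤ) : 𝓞 QSqrt2) = (a - b * intSqrtTwo) * π := by
        rw [hab']
        push_cast
        linear_combination ((b : 𝓞 QSqrt2) ^ 2) * intSqrtTwo_mul_self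
      rw [this]
      exact P.asIdeal.mul_mem_left _ hmem
    apply hprime.ne_top
    rw [Ideal.eq_top_iff_one]
    rcases Int.natAbs_eq_iff.1 h1 with h3 | h3 <;> rw [h3] at hnorm
    · simpa using hnorm
    · simpa using hnorm
  rw [hab, h.map_mul_map_int, ← Int.cast_abs]
  have h7 : (7 : ℤ) ≤ |a ^ 2 - 2 * b ^ 2| := by
    obtain ⟨c, rfl⟩ := Int.not_even_iff_odd.1 hodd
    obtain ⟨k, hk⟩ : ∃ k : ℤ, c * (c + 1) = 2 * k := (Int.even_mul_succ_self c).two_dvd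
    have ha : (2 * c + 1) ^ 2 = 8 * k + 1 := by linear_combination 4 * hk
    have hb : ∃ m : ℤ, 2 * b ^ 2 = 8 * m ∨ 2 * b ^ 2 = 8 * m + 2 := by
      rcases Int.even_or_odd' b with ⟨d, rfl | rfl⟩
      · exact ⟨d ^ 2, Or.inl (by ring)⟩
      · exact ⟨d ^ 2 + d, Or.inr (by ring)⟩
    obtain ⟨m, hm⟩ := hb
    rw [ha] at hunit ⊢
    rw [le_abs]
    rcases hm with hm | hm <;> rw [hm] at hunit ⊢ <;> omega
  exact_mod_cast h7

theorem exists_balanced_generator (P : HeightOneSpectrum (𝓞 QSqrt2)) {σ τ : QSqrt2 →+* ℝ}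
    (h : IsConjPair σ τ) (hσ : σ sqrtTwo = √2) : ∃ π : 𝓞 QSqrt2, P.asIdeal = Ideal.span {π} ∧
      |σ π| ≤ (1 + √2) * |τ π| ∧ |τ π| ≤ (1 + √2) * |σ π| := by
  obtain ⟨π, hπ⟩ := exists_generator P
  have hπ0 : (π : QSqrt2) ≠ 0 := PadicCF.coe_generator_ne_zero hπ
  have hs : √2 ^ 2 = (2 : ℝ) := Real.sq_sqrt zero_le_two
  have hs0 : 0 < √2 := by positivity
  set ε : ℝ := 1 + √2 with hε
  have hε0 : 0 < ε := by positivity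
  have hp : 0 < |σ π| := by simpa using hπ0
  have ht : 0 < |τ π| := by simpa using hπ0
  -- The unit `ε ^ (-n)` divides `|σ π| / |τ π|` by `ε ^ (2 * n)`; the extra factor `ε` centres the
  -- target interval at `[ε⁻¹, ε)`.
  obtain ⟨n, hn1, hn2⟩ := exists_mem_Ico_zpow (x := ε * |σ π| / |τ π|) (y := ε ^ 2)
    (by positivity) (by nlinarith)
  rw [le_div_iff₀ ht] at hn1
  rw [div_lt_iff₀ ht] at hn2
  have hcoe : (((fundUnit ^ (-n) : (𝓞 QSqrt2)ˣ) : 𝓞 QSqrt2) : QSqrt2) = (1 + sqrtTwo) ^ (-n) := by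
    have := map_zpow (Units.map (algebraMap (𝓞 QSqrt2) QSqrt2).toMonoidHom) fundUnit (-n)
    have := congrArg Units.val this
    rw [Units.val_zpow_eq_zpow_val] at this
    refine this.trans (congrArg (· ^ (-n)) ?_)
    change algebraMap (𝓞 QSqrt2) QSqrt2 (1 + intSqrtTwo) = 1 + sqrtTwo
    rw [map_add, map_one, ← RingOfIntegers.coe_eq_algebraMap, coe_intSqrtTwo]
  have hσu : |σ ((1 + sqrtTwo) ^ (-n))| = (ε ^ n)⁻¹ := by
    rw [map_zpow₀, map_add, map_one, hσ, abs_zpow, abs_of_pos hε0, zpow_neg]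
  have hτu : |τ ((1 + sqrtTwo) ^ (-n))| = ε ^ n := by
    have : |1 + -√2| = ε⁻¹ := by
      rw [abs_of_neg (by nlinarith)]
      apply eq_inv_of_mul_eq_one_left
      linear_combination hs
    rw [map_zpow₀, map_add, map_one, h.neg, hσ, abs_zpow, this, inv_zpow, zpow_neg, inv_inv]
  have hpow : 0 < ε ^ n := by positivity
  have hsq : (ε ^ 2) ^ n = (ε ^ n) ^ 2 := by rw [sq, mul_zpow, sq]
  refine ⟨(fundUnit ^ (-n) : (𝓞 QSqrt2)ˣ) * π, ?_, ?_, ?_⟩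
  · rw [hπ, Ideal.span_singleton_eq_span_singleton]
    exact (associated_unit_mul_left _ _ (Units.isUnit _)).symm
  all_goals
    rw [RingOfIntegers.coe_eq_algebraMap, map_mul, ← RingOfIntegers.coe_eq_algebraMap,
      ← RingOfIntegers.coe_eq_algebraMap, hcoe, map_mul, map_mul, abs_mul, abs_mul, hσu, hτu]
  · rw [inv_mul_le_iff₀ hpow]
    rw [zpow_add_one₀ (by positivity), hsq] at hn2
    refine le_of_mul_le_mul_left (hn2.le.trans_eq ?_) hε0
    ring
  · rw [mul_left_comm, ← div_eq_inv_mul, le_div_iff₀ hpow]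
    rw [hsq] at hn1
    refine le_trans (le_of_eq ?_) hn1
    ring

end QSqrt2

/-! ### Conclusion, ordering the embeddings so that `|τ π| ≤ |σ π|` -/

theorem theorem6p2 (P : HeightOneSpectrum (𝓞 QSqrt2))
    (hP : Odd (ringChar (𝓞 QSqrt2 ⧸ P.asIdeal))) :
    PadicCF.HasCFF QSqrt2 P := by
  have hcff : ∀ (σ τ : QSqrt2 →+* ℝ), QSqrt2.IsConjPair σ τ → ∀ π : 𝓞 QSqrt2,
      P.asIdeal = Ideal.span {π} → |τ π| ≤ |σ π| → |σ π| ≤ (1 + √2) * |τ π| →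
      PadicCF.HasCFF QSqrt2 P := by
    intro σ τ h π hπ h1 h2
    have hq := QSqrt2.seven_le_abs_norm hP hπ h
    have ht : 0 < |τ π| := by simpa using PadicCF.coe_generator_ne_zero hπ
    rw [abs_mul] at hq
    have hsq : (|σ π| * |τ π|) ^ 2 = (σ π * τ π) ^ 2 := by rw [← abs_mul, sq_abs]
    refine PadicCF.hasCFF_of_bound hπ σ τ h.one_le_abs (c := 199 / 200) (by norm_num) ?_ fun z => ?_
    · rw [← hsq]
      nlinarith
    · obtain ⟨l, x, y, hσ, hτ, hy, hx⟩ := h.exists_reduction z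
      refine ⟨l, ?_⟩
      have := QSqrt2.reduced_bound hy hx ht h1 h2 hq
      rwa [hsq, sq_abs, sq_abs, ← hσ, ← hτ, ← mul_pow, ← mul_pow, ← map_mul, ← map_mul] at this
  obtain ⟨σ, hσ⟩ := QSqrt2.exists_embedding (Real.sq_sqrt (zero_le_two (α := ℝ)))
  obtain ⟨τ, hτ⟩ := QSqrt2.exists_embedding (r := -√2) (by simp)
  have h : QSqrt2.IsConjPair σ τ := ⟨by simp [hσ], by rw [hσ, hτ]⟩
  obtain ⟨π, hπ, h1, h2⟩ := QSqrt2.exists_balanced_generator P h hσ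
  rcases le_total |τ π| |σ π| with hle | hle
  · exact hcff σ τ h π hπ hle h1
  · exact hcff τ σ h.symm π hπ hle h2
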